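/- **Model.** Consider a slotted-time network with finite sets of nodes $V$, links $E$ (directed or undirected) and traffic classes $\mathcal K$. In slot $t=0,1,2,\dots$ link $e$ is ON ($\sigma_e(t)=1$) or OFF ($\sigma_e(t)=0$), where $\{\boldsymbol\sigma(t)\}_{t\ge 0}$ is a stationary ergodic process. A link $e$ that is ON and activated can transmit $c_e\ge 0$ packets in a slot; the set of links activated in a slot must belong to a given family $\mathcal M\subseteq 2^E$. Class $k$ has a source node, a set $\mathcal T^k$ of routes, each of which is a tree directed away from the source (paths from the source to the destination for unicast, trees spanning all nodes for broadcast, trees containing all destinations for multicast, paths from the source to any one of the destinations for anycast; any other family of such trees is allowed), and a non-decreasing strictly concave utility function $U_k:[0,\infty)\to[0,\infty)$. In each slot the number of packets admitted from a class must lie in a given set $X$ with $0\in X\subseteq[0,A_{\max}]$ (for instance $X=[0,A_{\max}]$, or the integers in this interval). Fix $V_0>0$. **UMW+.** If in slot $t$ the policy admits $A^k(t)$ packets of each class $k$, all of them assigned the route $T^k(t)\in\mathcal T^k$, and activates the links $\mu(t)\in\mathcal M$, the virtual queues evolve as $$\tilde Q_e(0)=0,\qquad \tilde Q_e(t+1)=\Big(\tilde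 Q_e(t)+\sum_{k}A^k(t)\mathbb 1(e\in T^k(t))-c_e\sigma_e(t)\mathbb 1(e\in\mu(t))\Big)^+ .$$ UMW+ chooses (ties broken arbitrarily) $T^k(t)\in\arg\min_{T\in\mathcal T^k}\sum_{e\in T}\tilde Q_e(t)$ with minimum $C_k(t)$; $A^k(t)\in\arg\min_{x\in X}\big(C_k(t)x-V_0U_k(x)\big)$; and $\mu(t)\in\arg\max_{M\in\mathcal M}\sum_{e\in M}c_e\tilde Q_e(t)\sigma_e(t)$. **Physical network.** The physical network starts empty and uses the same admissions, routes and link activations. A packet makes the hops of its route in order, at most one hop per slot, the first one possibly in its admission slot; where its route branches, a copy is made for each outgoing link. In slot $t$ link $e$ can serve $c_e\sigma_e(t)\mathbb 1(e\in\mu(t))$ packets. Contention is resolved by the Extended Nearest-to-Origin (ENTO) discipline: each link serves as many of its waiting packets as its service in the slot allows, and a packet that has traversed fewer hops from its source has priority over a packet that has traversed more (ties broken arbitrarily). Let $Q_e(T)$ be the number of packets waiting to cross $e$ at the beginning of slot $T$. **Theorem.** Under UMW+ with the ENTO packet scheduling discipline, the physical queues are almost surely rate stable: $$\lim_{T\to\infty}\frac1T\sum_{e\in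 E}Q_e(T)=0\qquad\text{with probability }1.$$ -/

import Mathlib

open MeasureTheory Filter Topology

universe u v w

/-- The type of a traffic class over the nodes `V` and links `E`, with its source node.
A route is a finite set of directed link traversals `(e, d) : E × Bool` (`d = false`: the link `e`
is crossed from its tail to its head, `d = true`: from its head to its tail).
The last constructor is a further class type, given by an arbitrary family of candidate routes. -/
inductive TrafficType (V : Type u) (E : Type v) : Type (max u v)
  | unicast (source dest : V)
  | broadcast (source : V)
  | multicast (source : V) (dests : Set V)
  | anycast (source : V) (dests : Set V)
  | other (source : V) (candidates : Set (Finset (E × Bool)))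

/-- The source node of a traffic type. -/
def TrafficType.source {V : Type u} {E : Type v} : TrafficType V E → V
  | .unicast s _ => s
  | .broadcast s => s
  | .multicast s _ => s
  | .anycast s _ => s
  | .other s _ => s

/-- A wireless network with nodes `V`, links `E` and traffic classes `K`. -/
structure Network (V : Type u) (E : Type v) (K : Type w) where
  /-- the endpoints of a link -/
  tail : E → V
  head : E → V
  /-- links that may also be crossed from head to tail; an undirected graph has all links two-way,
  a directed graph has none -/
  twoWay : Set E
  /-- `cap e` packets can be transmitted in a slot by an active link `e` that is ON -/
  cap : E → ℝ
  cap_nonneg : ∀ e, 0 ≤ cap e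
  /-- the sets of links that may be activated together -/
  interferenceFree : Set (Finset E)
  /-- the type of each traffic class -/
  traffic : K → TrafficType V E
  /-- the utility functions on `[0, ∞)` -/
  utility : K → ℝ → ℝ
  utility_nonneg : ∀ k x, 0 ≤ x → 0 ≤ utility k x
  utility_mono : ∀ k, MonotoneOn (utility k) (Set.Ici 0)
  utility_concave : ∀ k, StrictConcaveOn ℝ (Set.Ici 0) (utility k)
  /-- at most `maxAdmit` packets can be admitted from any class per slot -/
  maxAdmit : ℝ
  /-- the numbers of packets that can be admitted from a class in a slot: the interval
  `[0, maxAdmit]`, or only the integers in it if packets are not divisible -/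
  admissible : Set ℝ
  zero_admissible : (0 : ℝ) ∈ admissible
  admissible_subset : admissible ⊆ Set.Icc 0 maxAdmit

namespace Network

variable {V : Type u} {E : Type v} {K : Type w} (N : Network V E K)

/-- The node from which a link traversal starts. -/
def src (a : E × Bool) : V := if a.2 then N.head a.1 else N.tail a.1

/-- The node at which a link traversal ends. -/
def dst (a : E × Bool) : V := if a.2 then N.tail a.1 else N.head a.1

/-- `N.Reaches r T n v`: following `n` traversals of `T` from `r`, one arrives at `v`. -/
inductive Reaches (r : V) (T : Finset (E × Bool)) : ℕ → V → Prop
  | root : Reaches r T 0 r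
  | step {n : ℕ} (a : E × Bool) : a ∈ T → Reaches r T n (N.src a) → Reaches r T (n + 1) (N.dst a)

/-- `T` is a tree rooted at `r`, with its edges directed away from `r`. -/
structure IsTree (r : V) (T : Finset (E × Bool)) : Prop where
  direction : ∀ a ∈ T, a.2 = true → a.1 ∈ N.twoWay
  reachable : ∀ a ∈ T, ∃ n, N.Reaches r T n (N.src a)
  not_into_root : ∀ a ∈ T, N.dst a ≠ r
  unique_entry : ∀ a ∈ T, ∀ b ∈ T, N.dst a = N.dst b → a = b

/-- The node `v` lies on the tree `T` rooted at `r`. -/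
def Covers (r : V) (T : Finset (E × Bool)) (v : V) : Prop := v = r ∨ ∃ a ∈ T, N.dst a = v

/-- `T` is a (simple) path from `r` to `v`: a tree rooted at `r` which does not branch
and ends at `v`. -/
structure IsPath (r v : V) (T : Finset (E × Bool)) : Prop where
  tree : N.IsTree r T
  unique_exit : ∀ a ∈ T, ∀ b ∈ T, N.src a = N.src b → a = b
  covers_end : N.Covers r T v
  stops : ∀ a ∈ T, N.src a ≠ v

/-- The routes of each traffic type. -/
def routesOf : TrafficType V E → Set (Finset (E × Bool))
  | .unicast s t => {T | N.IsPath s t T}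
  | .broadcast s => {T | N.IsTree s T ∧ ∀ v, N.Covers s T v}
  | .multicast s D => {T | N.IsTree s T ∧ ∀ v ∈ D, N.Covers s T v}
  | .anycast s D => {T | ∃ t ∈ D, N.IsPath s t T}
  | .other s R => {T | N.IsTree s T ∧ T ∈ R}

/-- The source node of class `k`. -/
def source (k : K) : V := (N.traffic k).source

/-- The set of all routes of class `k`. -/
def routes (k : K) : Set (Finset (E × Bool)) := N.routesOf (N.traffic k)

/-- The number of hops from the source `r` to the node `v` along the tree `T`. -/
noncomputable def hops (r : V) (T : Finset (E × Bool)) (v : V) : ℕ :=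
  sInf {n | N.Reaches r T n v}

end Network

/-- The decisions of a control policy on one sample path, for all slots `t = 0, 1, 2, …`. All
packets of class `k` admitted in slot `s` form the batch `(k, s)`; they share one route. -/
structure Controls (E : Type v) (K : Type w) where
  /-- `admitted t k`: the number of packets admitted from class `k` in slot `t` -/
  admitted : ℕ → K → ℝ
  /-- `route t k`: the route assigned to the packets of class `k` admitted in slot `t` -/
  route : ℕ → K → Finset (E × Bool)
  /-- `active t`: the set of links activated in slot `t` -/
  active : ℕ → Finset E
  /-- `sent t k s a`: the number of packets of the batch `(k, s)` which make the link traversal `a`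
  in slot `t` in the physical network -/
  sent : ℕ → K → ℕ → E × Bool → ℝ

namespace Controls

variable {V : Type u} {E : Type v} {K : Type w}
variable (N : Network V E K) (link : ℕ → E → Bool) (C : Controls E K)

open Classical in
/-- The number of packets that link `e` can serve in slot `t` (it must be active and ON). -/
noncomputable def service (t : ℕ) (e : E) : ℝ :=
  if e ∈ C.active t ∧ link t e = true then N.cap e else 0

open Classical in
/-- The arrivals to the virtual queue of link `e` in slot `t`: the packets admitted in slot `t`
whose route uses `e`. -/
noncomputable def virtualArrival [Fintype K] (t : ℕ) (e : E) : ℝ :=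
  ∑ k, if ∃ d, (e, d) ∈ C.route t k then C.admitted t k else 0

/-- The virtual queues, initially empty. -/
noncomputable def virtualQueue [Fintype K] : ℕ → E → ℝ
  | 0, _ => 0
  | t + 1, e => max (virtualQueue t e + C.virtualArrival t e - C.service N link t e) 0

open Classical in
/-- The cost of a route in the network weighted by the virtual queues at slot `t`. -/
noncomputable def routeCost [Fintype E] [Fintype K] (t : ℕ) (T : Finset (E × Bool)) : ℝ :=
  ∑ e, if ∃ d, (e, d) ∈ T then C.virtualQueue N link t e else 0

open Classical in
/-- The weight of a set of links in slot `t`: the sum of capacity times virtual queue length over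
its links that are ON. -/
noncomputable def linkWeight [Fintype K] (t : ℕ) (M : Finset E) : ℝ :=
  ∑ e ∈ M, if link t e = true then N.cap e * C.virtualQueue N link t e else 0

/-- The admission, routing and link activation decisions are those of the UMW+ policy with
parameter `β` (the factor of the utilities in the objective). Ties may be broken arbitrarily. -/
structure IsUMWPlus [Fintype E] [Fintype K] (β : ℝ) : Prop where
  /-- the route of class `k` is a shortest route -/
  route_mem : ∀ t k, C.route t k ∈ N.routes k
  route_min : ∀ t k, ∀ T ∈ N.routes k,
    C.routeCost N link t (C.route t k) ≤ C.routeCost N link t T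
  /-- the number of admitted packets minimizes shortest route cost times `x` minus `β` times the
  utility of `x` -/
  admit_mem : ∀ t k, C.admitted t k ∈ N.admissible
  admit_min : ∀ t k, ∀ x ∈ N.admissible,
    C.routeCost N link t (C.route t k) * C.admitted t k - β * N.utility k (C.admitted t k)
      ≤ C.routeCost N link t (C.route t k) * x - β * N.utility k x
  /-- a max-weight set of links is activated -/
  active_mem : ∀ t, C.active t ∈ N.interferenceFree
  active_max : ∀ t, ∀ M ∈ N.interferenceFree,
    C.linkWeight N link t M ≤ C.linkWeight N link t (C.active t)

open Classical in
/-- The packets of the batch `(k, s)` admitted from outside in slot `t`, in order to make the link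
traversal `a` as their first hop. -/
noncomputable def externalArrival (t : ℕ) (k : K) (s : ℕ) (a : E × Bool) : ℝ :=
  if t = s ∧ a ∈ C.route s k ∧ N.src a = N.source k then C.admitted s k else 0

open Classical in
/-- The packets of the batch `(k, s)` which have reached, in slot `t`, the node where the link
traversal `a` of their route starts (a copy is made for each such `a`). -/
noncomputable def forwarded (t : ℕ) (k : K) (s : ℕ) (a : E × Bool) : ℝ :=
  if a ∈ C.route s k then
    ∑ b ∈ C.route s k, if N.dst b = N.src a then C.sent t k s b else 0
  else 0

/-- The number of packets of the batch `(k, s)` waiting at the beginning of slot `t` to make the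
link traversal `a`. The physical network is initially empty; packets that cross a link in a slot
can cross the next link from the next slot on. -/
noncomputable def waiting : ℕ → K → ℕ → E × Bool → ℝ
  | 0, _, _, _ => 0
  | t + 1, k, s, a => waiting t k s a + C.externalArrival N t k s a - C.sent t k s a
      + C.forwarded N t k s a

/-- The number of packets of the batch `(k, s)` that can make the traversal `a` in slot `t`. -/
noncomputable def present (t : ℕ) (k : K) (s : ℕ) (a : E × Bool) : ℝ :=
  C.waiting N t k s a + C.externalArrival N t k s a

/-- The number of packets which cross link `e` in slot `t` in the physical network. -/
noncomputable def totalSent [Fintype K] (t : ℕ) (e : E) : ℝ :=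
  ∑ k, ∑ s ∈ Finset.range (t + 1), ∑ d, C.sent t k s (e, d)

/-- The number of hops which the packets of the batch `(k, s)` that wait to make the
traversal `a` are away from their source. -/
noncomputable def age (k : K) (s : ℕ) (a : E × Bool) : ℕ :=
  N.hops (N.source k) (C.route s k) (N.src a)

/-- The packet transmissions in the physical network follow the Extended Nearest to Origin
discipline: each link serves as many packets as its service allows, those with fewer hops from
their source first. Ties may be broken arbitrarily. -/
structure IsENTO [Fintype K] : Prop where
  sent_nonneg : ∀ t k s a, 0 ≤ C.sent t k s a
  sent_le : ∀ t k s a, C.sent t k s a ≤ C.present N t k s a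
  total_le : ∀ t e, C.totalSent t e ≤ C.service N link t e
  /-- packets are left behind only if the service of the link is used up -/
  work_conserving : ∀ t k s a, C.sent t k s a < C.present N t k s a →
    C.totalSent t a.1 = C.service N link t a.1
  /-- and only if no packet further from its source crosses the same link -/
  nearest_first : ∀ t k s a k' s' a', C.sent t k s a < C.present N t k s a →
    a'.1 = a.1 → C.age N k s a < C.age N k' s' a' → C.sent t k' s' a' = 0

/-- The physical queue of link `e` at the beginning of slot `t`: the number of all packets
waiting to cross `e` (the batches present were admitted in the slots `s < t`). -/
noncomputable def physicalQueue [Fintype K] (t : ℕ) (e : E) : ℝ :=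
  ∑ k, ∑ s ∈ Finset.range t, ∑ d, C.waiting N t k s (e, d)

end Controls

/-- The random process `σ` with values in `S` is stationary and ergodic: its law is invariant and
ergodic under the time shift. -/
def IsStationaryErgodic {Ω : Type*} [MeasurableSpace Ω] {S : Type*} [MeasurableSpace S]
    (σ : Ω → ℕ → S) (P : Measure Ω) : Prop :=
  Measurable σ ∧ Ergodic (fun (x : ℕ → S) (t : ℕ) => x (t + 1)) (P.map σ)

/-! The argument is pathwise.

*Virtual queues.* Comparing the admitted amount with `0` shows that under UMW+ the product of
the admitted amount and the route cost is at most `β * U_k(maxAdmit)`. This product is the only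
positive first-order term in the drift of `∑ e, virtualQueue e ^ 2`, which therefore grows at most
linearly (`sum_sq_virtualQueue_le`). So the virtual queues are of order `√t`, and over any window
`[t₀, t)` the packets admitted for a link exceed its service by at most `O(√t)`
(`sum_arrival_sub_service_le`).

*Physical queues.* Let `queueBelow H n t e` count the packets at link `e` that have made fewer than
`n` hops. Under ENTO these packets do not notice the others, so the service of `e` is entirely
spent on them as long as some of them are left behind (`exists_queueBelow_le_sum`). During such a
period, a packet that arrives at `e` was either admitted during the period, and is then counted in
the arrivals to the virtual queue, or was waiting upstream at the beginning of the period, with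
fewer hops made (`sum_inflow_le`). Hence the queues of packets with fewer than `n + 1` hops are at
most `O(√t)` plus the sum of the queues of packets with fewer than `n` hops at an earlier time
(`queueBelow_succ_le`). The number of hops in a tree is bounded by the number of link traversals,
so finitely many such steps bound the physical queues by `O(√t)`, which is `o(t)`. -/

/-! ### Trees -/

namespace Network

variable {V : Type u} {E : Type v} {K : Type w} {N : Network V E K}

lemma isTree_of_mem_routes {k : K} {T : Finset (E × Bool)} (h : T ∈ N.routes k) :
    N.IsTree (N.source k) T := by
  unfold routes at h
  unfold source
  cases hk : N.traffic k with
  | unicast s t => rw [hk] at h; exact IsPath.tree h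
  | broadcast s => rw [hk] at h; exact h.1
  | multicast s D => rw [hk] at h; exact h.1
  | anycast s D =>
    rw [hk] at h
    obtain ⟨t, -, ht⟩ := h
    exact ht.tree
  | other s R => rw [hk] at h; exact h.1

variable {r : V} {T : Finset (E × Bool)}

/-- In a tree, a traversal that does not start at the root is preceded by a traversal that starts
one hop closer to the root. -/
lemma IsTree.exists_parent (hT : N.IsTree r T) {a : E × Bool} (ha : a ∈ T) (hr : N.src a ≠ r) :
    ∃ b ∈ T, N.dst b = N.src a ∧ N.hops r T (N.src b) + 1 = N.hops r T (N.src a) := by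
  have hmem : N.Reaches r T (N.hops r T (N.src a)) (N.src a) := Nat.sInf_mem (hT.reachable a ha)
  generalize hn : N.hops r T (N.src a) = n at hmem
  generalize hv : N.src a = v at hmem
  cases hmem with
  | root => exact absurd hv hr
  | @step n b hb hreach =>
    refine ⟨b, hb, rfl, ?_⟩
    have h1 : N.hops r T (N.src b) ≤ n := Nat.sInf_le hreach
    have h2 : N.hops r T (N.src a) ≤ N.hops r T (N.src b) + 1 := by
      have h3 : N.Reaches r T (N.hops r T (N.src b)) (N.src b) :=
        Nat.sInf_mem (hT.reachable b hb)
      have h4 := Reaches.step b hb h3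
      rw [← hv] at h4
      exact Nat.sInf_le h4
    omega

lemma hops_root : N.hops r T r = 0 := Nat.le_zero.1 (Nat.sInf_le Reaches.root)

/-- A tree crosses every link in at most one direction: otherwise each of the two traversals would
be the parent of the other. -/
lemma IsTree.direction_unique (hT : N.IsTree r T) {e : E} {d d' : Bool} (h : (e, d) ∈ T)
    (h' : (e, d') ∈ T) : d = d' := by
  by_contra hne
  have key : ∀ d : Bool, (e, d) ∈ T → (e, !d) ∈ T →
      N.hops r T (N.src (e, !d)) + 1 = N.hops r T (N.src (e, d)) := by
    intro d h h'
    have hs : N.src (e, d) = N.dst (e, !d) := by cases d <;> simp [src, dst]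
    obtain ⟨b, hb, hb', hlt⟩ := hT.exists_parent h (hs ▸ hT.not_into_root _ h')
    rw [hs] at hb'
    rwa [hT.unique_entry b hb _ h' hb'] at hlt
  have hd : d' = !d := by cases d <;> cases d' <;> simp_all
  subst hd
  have h1 := key d h h'
  have h2 := key (!d) h' (by simpa using h)
  rw [Bool.not_not] at h2
  omega

lemma IsTree.hops_lt_card [Fintype E] (hT : N.IsTree r T) {a : E × Bool} (ha : a ∈ T) :
    N.hops r T (N.src a) < Fintype.card (E × Bool) := by
  -- All hop counts below that of `a` occur among the ancestors of `a`.
  have key : ∀ n, ∀ a ∈ T, N.hops r T (N.src a) = n →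
      Finset.range (n + 1) ⊆ T.image fun b => N.hops r T (N.src b) := by
    intro n
    induction n with
    | zero =>
      intro a ha h i hi
      have : i = 0 := by simpa using hi
      exact Finset.mem_image.2 ⟨a, ha, by omega⟩
    | succ n ih =>
      intro a ha h i hi
      rcases Nat.lt_succ_iff_lt_or_eq.1 (Finset.mem_range.1 hi) with hlt | rfl
      · obtain ⟨b, hb, -, hb'⟩ := hT.exists_parent ha fun h0 => by
          rw [h0, hops_root] at h
          omega
        exact ih b hb (by omega) (Finset.mem_range.2 hlt)
      · exact Finset.mem_image.2 ⟨a, ha, h⟩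
  have h1 := Finset.card_le_card (key _ a ha rfl)
  rw [Finset.card_range] at h1
  exact (h1.trans Finset.card_image_le).trans T.card_le_univ

end Network

namespace Controls

variable {V : Type u} {E : Type v} {K : Type w}
variable {N : Network V E K} {link : ℕ → E → Bool} {C : Controls E K}

/-! ### Virtual queues -/

lemma service_nonneg (t : ℕ) (e : E) : 0 ≤ C.service N link t e := by
  unfold service
  split_ifs
  exacts [N.cap_nonneg e, le_rfl]

lemma service_le (t : ℕ) (e : E) : C.service N link t e ≤ N.cap e := by
  unfold service
  split_ifs
  exacts [le_rfl, N.cap_nonneg e]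

lemma virtualQueue_nonneg [Fintype K] (t : ℕ) (e : E) : 0 ≤ C.virtualQueue N link t e := by
  cases t with
  | zero => exact le_rfl
  | succ t => exact le_max_right _ _

/-- Over any window, the arrivals to a virtual queue exceed the service by at most the final
virtual queue length. -/
lemma sum_arrival_sub_service_le [Fintype K] {t₀ t : ℕ} (h : t₀ ≤ t) (e : E) :
    ∑ τ ∈ Finset.Ico t₀ t, (C.virtualArrival τ e - C.service N link τ e)
      ≤ C.virtualQueue N link t e := by
  induction t, h using Nat.le_induction with
  | base => simpa using virtualQueue_nonneg t₀ e
  | succ t h ih =>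
    rw [Finset.sum_Ico_succ_top h]
    refine le_trans ?_ (le_max_left _ _)
    linarith

section UMWPlus

variable [Fintype E] [Fintype K] {β : ℝ}

namespace IsUMWPlus

lemma isTree (hU : C.IsUMWPlus N link β) (t : ℕ) (k : K) :
    N.IsTree (N.source k) (C.route t k) := Network.isTree_of_mem_routes (hU.route_mem t k)

lemma admitted_nonneg (hU : C.IsUMWPlus N link β) (t : ℕ) (k : K) : 0 ≤ C.admitted t k :=
  (N.admissible_subset (hU.admit_mem t k)).1

lemma admitted_le (hU : C.IsUMWPlus N link β) (t : ℕ) (k : K) :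
    C.admitted t k ≤ N.maxAdmit := (N.admissible_subset (hU.admit_mem t k)).2

/-- The cost of the admitted packets is bounded, since admitting nothing is an alternative. -/
lemma routeCost_mul_admitted_le (hU : C.IsUMWPlus N link β) (hβ : 0 < β) (t : ℕ) (k : K) :
    C.routeCost N link t (C.route t k) * C.admitted t k ≤ β * N.utility k N.maxAdmit := by
  have h0 := hU.admit_min t k 0 N.zero_admissible
  have h1 := N.utility_nonneg k 0 le_rfl
  have h2 := N.utility_mono k (hU.admitted_nonneg t k)
    ((hU.admitted_nonneg t k).trans (hU.admitted_le t k)) (hU.admitted_le t k)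
  nlinarith

lemma virtualArrival_nonneg (hU : C.IsUMWPlus N link β) (t : ℕ) (e : E) :
    0 ≤ C.virtualArrival t e :=
  Finset.sum_nonneg fun k _ => by
    split_ifs
    exacts [hU.admitted_nonneg t k, le_rfl]

lemma virtualArrival_le (hU : C.IsUMWPlus N link β) (t : ℕ) (e : E) :
    C.virtualArrival t e ≤ Fintype.card K * N.maxAdmit := by
  have h : C.virtualArrival t e ≤ ∑ _k : K, N.maxAdmit := Finset.sum_le_sum fun k _ => by
    split_ifs
    exacts [hU.admitted_le t k, (hU.admitted_nonneg t k).trans (hU.admitted_le t k)]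
  simpa using h

lemma sum_virtualQueue_mul_virtualArrival (t : ℕ) :
    ∑ e, C.virtualQueue N link t e * C.virtualArrival t e
      = ∑ k, C.routeCost N link t (C.route t k) * C.admitted t k := by
  simp only [virtualArrival, routeCost, Finset.mul_sum, Finset.sum_mul]
  rw [Finset.sum_comm]
  refine Finset.sum_congr rfl fun k _ => Finset.sum_congr rfl fun e _ => ?_
  split_ifs <;> simp

end IsUMWPlus

/-- A bound on the drift of the sum of the squares of the virtual queues under UMW+. -/
noncomputable def driftBound (N : Network V E K) (β : ℝ) : ℝ :=
  ∑ e, ((Fintype.card K * N.maxAdmit) ^ 2 + N.cap e ^ 2) + 2 * ∑ k, β * N.utility k N.maxAdmit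

namespace IsUMWPlus

lemma sum_sq_virtualQueue_le (hU : C.IsUMWPlus N link β) (hβ : 0 < β) (t : ℕ) :
    ∑ e, C.virtualQueue N link t e ^ 2 ≤ driftBound N β * t := by
  induction t with
  | zero => simp [virtualQueue]
  | succ t ih =>
    have h1 : ∀ e, C.virtualQueue N link (t + 1) e ^ 2 ≤ C.virtualQueue N link t e ^ 2
        + ((Fintype.card K * N.maxAdmit) ^ 2 + N.cap e ^ 2)
        + 2 * (C.virtualQueue N link t e * C.virtualArrival t e) := by
      intro e
      have hq := virtualQueue_nonneg (C := C) (N := N) (link := link) t e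
      have ha := hU.virtualArrival_nonneg t e
      have hs := service_nonneg (C := C) (N := N) (link := link) t e
      have ha2 : C.virtualArrival t e ^ 2 ≤ (Fintype.card K * N.maxAdmit) ^ 2 :=
        pow_le_pow_left₀ ha (hU.virtualArrival_le t e) 2
      have hs2 : C.service N link t e ^ 2 ≤ N.cap e ^ 2 :=
        pow_le_pow_left₀ hs (service_le t e) 2
      have hmax : C.virtualQueue N link (t + 1) e ^ 2 ≤
          (C.virtualQueue N link t e + C.virtualArrival t e - C.service N link t e) ^ 2 := by
        simp only [virtualQueue]
        rcases le_total (C.virtualQueue N link t e + C.virtualArrival t e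
          - C.service N link t e) 0 with h | h
        · rw [max_eq_right h]
          exact (zero_pow two_ne_zero).trans_le (sq_nonneg _)
        · rw [max_eq_left h]
      nlinarith [mul_nonneg hq hs, mul_nonneg ha hs]
    have h2 := Finset.sum_le_sum fun e (_ : e ∈ Finset.univ) => h1 e
    rw [Finset.sum_add_distrib, Finset.sum_add_distrib, ← Finset.mul_sum,
      sum_virtualQueue_mul_virtualArrival] at h2
    have h3 := Finset.sum_le_sum fun k (_ : k ∈ Finset.univ) =>
      hU.routeCost_mul_admitted_le hβ t k
    push_cast
    have hD : driftBound N β * (t + 1) = driftBound N β * t +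
      (∑ e, ((Fintype.card K * N.maxAdmit) ^ 2 + N.cap e ^ 2)
        + 2 * ∑ k, β * N.utility k N.maxAdmit) := by
      unfold driftBound
      ring
    rw [hD]
    linarith

lemma virtualQueue_le_sqrt (hU : C.IsUMWPlus N link β) (hβ : 0 < β) (t : ℕ) (e : E) :
    C.virtualQueue N link t e ≤ √(driftBound N β * t) :=
  Real.le_sqrt_of_sq_le <| le_trans
    (Finset.single_le_sum (f := fun e => C.virtualQueue N link t e ^ 2)
      (fun _ _ => sq_nonneg _) (Finset.mem_univ e))
    (hU.sum_sq_virtualQueue_le hβ t)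

lemma sqrt_driftBound_mono (hU : C.IsUMWPlus N link β) (hβ : 0 < β) :
    Monotone fun t : ℕ => √(driftBound N β * t) := by
  have hD : 0 ≤ driftBound N β := by
    have h := hU.sum_sq_virtualQueue_le hβ 1
    rw [Nat.cast_one, mul_one] at h
    exact le_trans (Finset.sum_nonneg fun _ _ => sq_nonneg _) h
  intro s t hst
  exact Real.sqrt_le_sqrt (mul_le_mul_of_nonneg_left (by exact_mod_cast hst) hD)

end IsUMWPlus

end UMWPlus

/-! ### The flow of a batch -/

/-- The packets of the batch `(k, s)` that start to wait for the traversal `a` in slot `t`, from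
outside or from the preceding link. -/
noncomputable def inflow (N : Network V E K) (C : Controls E K) (t : ℕ) (k : K) (s : ℕ)
    (a : E × Bool) : ℝ :=
  C.externalArrival N t k s a + C.forwarded N t k s a

lemma waiting_succ (t : ℕ) (k : K) (s : ℕ) (a : E × Bool) :
    C.waiting N (t + 1) k s a
      = C.waiting N t k s a + C.inflow N t k s a - C.sent t k s a := by
  simp only [waiting, inflow]
  ring

lemma waiting_eq_add_sum {t₀ t : ℕ} (h : t₀ ≤ t) (k : K) (s : ℕ) (a : E × Bool) :
    C.waiting N t k s a = C.waiting N t₀ k s a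
      + ∑ τ ∈ Finset.Ico t₀ t, C.inflow N τ k s a - ∑ τ ∈ Finset.Ico t₀ t, C.sent τ k s a := by
  induction t, h using Nat.le_induction with
  | base => simp
  | succ t h ih =>
    rw [Finset.sum_Ico_succ_top h, Finset.sum_Ico_succ_top h, waiting_succ, ih]
    ring

namespace IsENTO

variable [Fintype K]

lemma forwarded_nonneg (hE : C.IsENTO N link) (t : ℕ) (k : K) (s : ℕ) (a : E × Bool) :
    0 ≤ C.forwarded N t k s a := by
  unfold forwarded
  split_ifs
  · refine Finset.sum_nonneg fun b _ => ?_
    split_ifs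
    exacts [hE.sent_nonneg t k s b, le_rfl]
  · exact le_rfl

lemma waiting_nonneg (hE : C.IsENTO N link) (t : ℕ) (k : K) (s : ℕ) (a : E × Bool) :
    0 ≤ C.waiting N t k s a := by
  cases t with
  | zero => exact le_rfl
  | succ t =>
    have h1 := hE.sent_le t k s a
    have h2 := hE.forwarded_nonneg t k s a
    simp only [waiting, present] at h1 ⊢
    linarith

/-- Nothing of a batch waits at traversals outside of its route. -/
lemma waiting_eq_zero_of_notMem (hE : C.IsENTO N link) (t : ℕ) (k : K) (s : ℕ) (a : E × Bool)
    (ha : a ∉ C.route s k) : C.waiting N t k s a = 0 := by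
  induction t with
  | zero => rfl
  | succ t ih =>
    have h1 := hE.sent_le t k s a
    have h2 := hE.sent_nonneg t k s a
    have h3 : C.externalArrival N t k s a = 0 := if_neg fun h => ha h.2.1
    have h4 : C.forwarded N t k s a = 0 := if_neg ha
    rw [present, ih, h3] at h1
    rw [waiting, ih, h3, h4]
    linarith

lemma sent_eq_zero_of_waiting (hE : C.IsENTO N link) {t : ℕ} {k : K} {s : ℕ} (hts : t < s)
    {a : E × Bool} (h : C.waiting N t k s a = 0) : C.sent t k s a = 0 := by
  refine le_antisymm ?_ (hE.sent_nonneg t k s a)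
  have h3 : C.externalArrival N t k s a = 0 := if_neg fun h => by omega
  have h1 := hE.sent_le t k s a
  rwa [present, h, h3, add_zero] at h1

/-- Nothing of a batch waits before its admission. -/
lemma waiting_eq_zero_of_le (hE : C.IsENTO N link) {t : ℕ} {k : K} {s : ℕ} (hts : t ≤ s)
    (a : E × Bool) : C.waiting N t k s a = 0 := by
  induction t generalizing a with
  | zero => rfl
  | succ t ih =>
    have h0 : ∀ b, C.sent t k s b = 0 := fun b =>
      hE.sent_eq_zero_of_waiting hts (ih (by omega) b)
    have h3 : C.externalArrival N t k s a = 0 := if_neg fun h => by omega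
    have h4 : C.forwarded N t k s a = 0 := by simp [forwarded, h0]
    rw [waiting, ih (by omega), h3, h4, h0]
    simp

lemma sent_eq_zero_of_lt (hE : C.IsENTO N link) {t : ℕ} {k : K} {s : ℕ} (hts : t < s)
    (a : E × Bool) : C.sent t k s a = 0 :=
  hE.sent_eq_zero_of_waiting hts (hE.waiting_eq_zero_of_le hts.le a)

open Classical in
/-- The packets of a batch that arrive at a traversal `a` of its route during a window were either
admitted during this window or waiting upstream of `a` at its beginning. -/
lemma sum_inflow_le (hE : C.IsENTO N link) {k : K} {s : ℕ}
    (hT : N.IsTree (N.source k) (C.route s k)) {t₀ t : ℕ} (h : t₀ ≤ t) {a : E × Bool}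
    (ha : a ∈ C.route s k) :
    ∑ τ ∈ Finset.Ico t₀ t, C.inflow N τ k s a
      ≤ (if s ∈ Finset.Ico t₀ t then C.admitted s k else 0)
        + ∑ b ∈ C.route s k, if C.age N k s b < C.age N k s a
            then C.waiting N t₀ k s b else 0 := by
  have hterm : ∀ a b, 0 ≤ if C.age N k s b < C.age N k s a
      then C.waiting N t₀ k s b else 0 := fun a b => by
    split_ifs
    exacts [hE.waiting_nonneg t₀ k s b, le_rfl]
  induction hn : C.age N k s a using Nat.strong_induction_on generalizing a with
  | _ n ih =>
    subst hn
    by_cases hr : N.src a = N.source k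
    · have hf : ∀ τ, C.inflow N τ k s a = if s = τ then C.admitted s k else 0 := by
        intro τ
        have h1 : C.forwarded N τ k s a = 0 := by
          rw [forwarded, if_pos ha]
          refine Finset.sum_eq_zero fun b hb => if_neg fun hba => ?_
          exact hT.not_into_root b hb (hba.trans hr)
        rw [inflow, h1, externalArrival, add_zero]
        simp [ha, hr, eq_comm]
      simp only [hf, Finset.sum_ite_eq]
      exact le_add_of_nonneg_right (Finset.sum_nonneg fun b _ => hterm a b)
    · obtain ⟨b, hb, hba, hage⟩ := hT.exists_parent ha hr
      replace hage : C.age N k s b + 1 = C.age N k s a := hage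
      have hf : ∀ τ, C.inflow N τ k s a = C.sent τ k s b := by
        intro τ
        have h1 : C.externalArrival N τ k s a = 0 := if_neg fun h => hr h.2.2
        rw [inflow, h1, zero_add, forwarded, if_pos ha, Finset.sum_eq_single b]
        · exact if_pos hba
        · intro c hc hcb
          exact if_neg fun hca => hcb (hT.unique_entry c hc b hb (hca.trans hba.symm))
        · exact fun hb' => absurd hb hb'
      have h1 := waiting_eq_add_sum (C := C) (N := N) h k s b
      have h2 := hE.waiting_nonneg t k s b
      have h3 := ih _ (by omega) hb rfl
      simp only [hf]
      have h4 : (∑ c ∈ C.route s k, if C.age N k s c < C.age N k s b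
            then C.waiting N t₀ k s c else 0) + C.waiting N t₀ k s b
          ≤ ∑ c ∈ C.route s k, if C.age N k s c < C.age N k s a
            then C.waiting N t₀ k s c else 0 := by
        rw [← Finset.sum_erase_add _ _ hb, ← Finset.sum_erase_add (C.route s k) _ hb,
          if_neg (lt_irrefl _), if_pos (by omega), add_zero]
        refine add_le_add_left (Finset.sum_le_sum fun c _ => ?_) _
        have hw := hE.waiting_nonneg t₀ k s c
        split_ifs <;> first | omega | linarith
      linarith

end IsENTO

/-! ### The queues of packets with few hops -/

section Queues

variable [Fintype K]

open Classical in
/-- The sum of `f k s (e, d)` over the directions `d` of the link `e` and all batches `(k, s)` with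
`s < H` for which the traversal `(e, d)` is less than `n` hops away from the source. For a horizon
`H` that is not before the current slot, all batches in the network are counted; a fixed horizon
keeps the range of the sum constant in time. -/
noncomputable def sumBelow (N : Network V E K) (C : Controls E K) (H n : ℕ) (e : E)
    (f : K → ℕ → E × Bool → ℝ) : ℝ :=
  ∑ k, ∑ s ∈ Finset.range H, ∑ d, if C.age N k s (e, d) < n then f k s (e, d) else 0

/-- The number of packets with less than `n` hops made that wait for the link `e` at the beginning
of slot `t`, among those admitted before slot `H`. -/
noncomputable def queueBelow (N : Network V E K) (C : Controls E K) (H n t : ℕ) (e : E) : ℝ :=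
  C.sumBelow N H n e (C.waiting N t)

lemma sumBelow_add (H n : ℕ) (e : E) (f g : K → ℕ → E × Bool → ℝ) :
    C.sumBelow N H n e (fun k s a => f k s a + g k s a)
      = C.sumBelow N H n e f + C.sumBelow N H n e g := by
  simp only [sumBelow, ← Finset.sum_add_distrib]
  refine Finset.sum_congr rfl fun k _ => Finset.sum_congr rfl fun s _ =>
    Finset.sum_congr rfl fun d _ => ?_
  split_ifs <;> simp

lemma sumBelow_sub (H n : ℕ) (e : E) (f g : K → ℕ → E × Bool → ℝ) :
    C.sumBelow N H n e (fun k s a => f k s a - g k s a)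
      = C.sumBelow N H n e f - C.sumBelow N H n e g := by
  simp only [sumBelow, ← Finset.sum_sub_distrib]
  refine Finset.sum_congr rfl fun k _ => Finset.sum_congr rfl fun s _ =>
    Finset.sum_congr rfl fun d _ => ?_
  split_ifs <;> simp

lemma sumBelow_sum (H n : ℕ) (e : E) (I : Finset ℕ) (f : ℕ → K → ℕ → E × Bool → ℝ) :
    C.sumBelow N H n e (fun k s a => ∑ τ ∈ I, f τ k s a)
      = ∑ τ ∈ I, C.sumBelow N H n e (f τ) := by
  classical
  induction I using Finset.induction_on with
  | empty => simp [sumBelow]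
  | insert i I hi ih =>
    simp only [Finset.sum_insert hi]
    rw [sumBelow_add, ih]

lemma sumBelow_nonneg (H n : ℕ) (e : E) {f : K → ℕ → E × Bool → ℝ} (hf : ∀ k s a, 0 ≤ f k s a) :
    0 ≤ C.sumBelow N H n e f := by
  refine Finset.sum_nonneg fun k _ => Finset.sum_nonneg fun s _ => Finset.sum_nonneg fun d _ => ?_
  split_ifs
  exacts [hf _ _ _, le_rfl]

namespace IsENTO

lemma sumBelow_forwarded_le_inflow (hU : ∀ t k, 0 ≤ C.admitted t k) (H n t : ℕ) (e : E) :
    C.sumBelow N H n e (C.forwarded N t) ≤ C.sumBelow N H n e (C.inflow N t) := by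
  have h : C.sumBelow N H n e (C.inflow N t) = C.sumBelow N H n e (C.externalArrival N t)
      + C.sumBelow N H n e (C.forwarded N t) := sumBelow_add H n e _ _
  have h0 : 0 ≤ C.sumBelow N H n e (C.externalArrival N t) := sumBelow_nonneg H n e fun k s a => by
    unfold externalArrival
    split_ifs
    exacts [hU s k, le_rfl]
  linarith

/-- If in slot `t` the link `e` leaves behind a packet with less than `n` hops made, then it spends
all of its service on such packets. -/
lemma sumBelow_sent_eq_service (hE : C.IsENTO N link) {H n t : ℕ} (htH : t < H) {e : E} {k : K}
    {s : ℕ} {d : Bool} (hage : C.age N k s (e, d) < n)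
    (hleft : C.sent t k s (e, d) < C.present N t k s (e, d)) :
    C.sumBelow N H n e (C.sent t) = C.service N link t e := by
  rw [← hE.work_conserving t k s (e, d) hleft]
  unfold sumBelow totalSent
  refine Finset.sum_congr rfl fun k' _ => ?_
  refine Eq.trans ?_ (Finset.sum_subset (Finset.range_mono htH) fun s' _ hs' => ?_).symm
  · refine Finset.sum_congr rfl fun s' _ => Finset.sum_congr rfl fun d' _ => ?_
    split_ifs with h
    · rfl
    · exact (hE.nearest_first t k s (e, d) k' s' (e, d') hleft rfl (by omega)).symm
  · exact Finset.sum_eq_zero fun d' _ => hE.sent_eq_zero_of_lt (by simpa using hs') _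

lemma queueBelow_succ (H n t : ℕ) (e : E) :
    C.queueBelow N H n (t + 1) e = C.queueBelow N H n t e + C.sumBelow N H n e (C.inflow N t)
      - C.sumBelow N H n e (C.sent t) := by
  unfold queueBelow
  rw [← sumBelow_add, ← sumBelow_sub]
  congr 1
  funext k s a
  exact waiting_succ t k s a

/-- The queue of packets with less than `n` hops is bounded by the excess of the inflow over the
service since the last slot `t₀` in which none of them was left behind. The term `N.cap e` makes up
for the service of slot `t₀` itself, which need not be used up. -/
lemma exists_queueBelow_le_sum (hE : C.IsENTO N link) (hU : ∀ t k, 0 ≤ C.admitted t k)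
    {H : ℕ} (n : ℕ) {t : ℕ} (htH : t ≤ H) (e : E) :
    ∃ t₀ ≤ t, C.queueBelow N H n t e ≤ ∑ τ ∈ Finset.Ico t₀ t,
      (C.sumBelow N H n e (C.inflow N τ) - C.service N link τ e) + N.cap e := by
  induction t with
  | zero => exact ⟨0, le_rfl, by simpa [queueBelow, sumBelow, waiting] using N.cap_nonneg e⟩
  | succ t ih =>
    by_cases hleft : ∃ k s d, C.age N k s (e, d) < n ∧
        C.sent t k s (e, d) < C.present N t k s (e, d)
    · obtain ⟨k, s, d, hage, hlt⟩ := hleft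
      obtain ⟨t₀, ht₀, h⟩ := ih (by omega)
      refine ⟨t₀, by omega, ?_⟩
      rw [Finset.sum_Ico_succ_top ht₀, queueBelow_succ,
        hE.sumBelow_sent_eq_service (by omega) hage hlt]
      linarith
    · push Not at hleft
      refine ⟨t, by omega, ?_⟩
      have h1 : C.queueBelow N H n (t + 1) e = C.sumBelow N H n e (C.forwarded N t) := by
        unfold queueBelow sumBelow
        refine Finset.sum_congr rfl fun k _ => Finset.sum_congr rfl fun s _ =>
          Finset.sum_congr rfl fun d _ => ?_
        split_ifs with h
        · have h2 := le_antisymm (hE.sent_le t k s (e, d)) (hleft k s d h)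
          rw [waiting, h2, present]
          ring
        · rfl
      have h2 := sumBelow_forwarded_le_inflow (C := C) (N := N) hU H n t e
      have h3 := service_le (C := C) (N := N) (link := link) t e
      simp only [Nat.Ico_succ_singleton, Finset.sum_singleton]
      linarith

end IsENTO

variable [Fintype E] {β : ℝ}

/-- The packets with at most `n` hops that arrive at the link `e` during a window were either
counted in the virtual queue of `e` during this window, or had made fewer than `n` hops at its
beginning. -/
lemma sum_sumBelow_inflow_le (hU : C.IsUMWPlus N link β) (hE : C.IsENTO N link) {H n t₀ t : ℕ}
    (h : t₀ ≤ t) (htH : t ≤ H) (e : E) :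
    ∑ τ ∈ Finset.Ico t₀ t, C.sumBelow N H (n + 1) e (C.inflow N τ)
      ≤ ∑ τ ∈ Finset.Ico t₀ t, C.virtualArrival τ e + ∑ e', C.queueBelow N H n t₀ e' := by
  classical
  rw [← sumBelow_sum]
  have hadm : ∑ τ ∈ Finset.Ico t₀ t, C.virtualArrival τ e = ∑ k, ∑ s ∈ Finset.range H,
      if s ∈ Finset.Ico t₀ t then (if ∃ d, (e, d) ∈ C.route s k then C.admitted s k else 0)
        else 0 := by
    unfold virtualArrival
    rw [Finset.sum_comm]
    refine Finset.sum_congr rfl fun k _ => ?_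
    refine Eq.trans (Finset.sum_congr ?_ fun s _ => by congr) (Finset.sum_filter _ _)
    ext s
    simp only [Finset.mem_filter, Finset.mem_range, Finset.mem_Ico]
    omega
  have hup : ∑ e', C.queueBelow N H n t₀ e' = ∑ k, ∑ s ∈ Finset.range H, ∑ b : E × Bool,
      if C.age N k s b < n then C.waiting N t₀ k s b else 0 := by
    unfold queueBelow sumBelow
    rw [Finset.sum_comm]
    refine Finset.sum_congr rfl fun k _ => ?_
    rw [Finset.sum_comm]
    refine Finset.sum_congr rfl fun s _ => ?_
    rw [Fintype.sum_prod_type]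
  rw [hadm, hup, ← Finset.sum_add_distrib]
  refine Finset.sum_le_sum fun k _ => ?_
  rw [← Finset.sum_add_distrib]
  refine Finset.sum_le_sum fun s _ => ?_
  have hT := hU.isTree s k
  have hA := hU.admitted_nonneg s k
  have hw : ∀ b, 0 ≤ if C.age N k s b < n then C.waiting N t₀ k s b else 0 := fun b => by
    split_ifs
    exacts [hE.waiting_nonneg t₀ k s b, le_rfl]
  have hinfl : ∀ d, (e, d) ∉ C.route s k →
      ∑ τ ∈ Finset.Ico t₀ t, C.inflow N τ k s (e, d) = 0 := fun d hd =>
    Finset.sum_eq_zero fun τ _ => by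
      have h3 : C.externalArrival N τ k s (e, d) = 0 := if_neg fun h => hd h.2.1
      have h4 : C.forwarded N τ k s (e, d) = 0 := if_neg hd
      rw [inflow, h3, h4, add_zero]
  by_cases hd : ∃ d, (e, d) ∈ C.route s k
  · -- The route crosses `e` in one direction only, as in the arrivals to the virtual queue.
    obtain ⟨d, hd⟩ := hd
    rw [Finset.sum_eq_single d]
    · have hex : ∃ d, (e, d) ∈ C.route s k := ⟨d, hd⟩
      rw [if_pos hex]
      by_cases hage : C.age N k s (e, d) < n + 1
      · rw [if_pos hage]
        refine (hE.sum_inflow_le hT h hd).trans ?_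
        refine add_le_add_right ?_ _
        refine (Finset.sum_le_sum fun b _ => ?_).trans
          (Finset.sum_le_sum_of_subset_of_nonneg (Finset.subset_univ _) fun b _ _ => hw b)
        have hwb := hE.waiting_nonneg t₀ k s b
        split_ifs <;> first | omega | linarith
      · rw [if_neg hage]
        refine add_nonneg ?_ (Finset.sum_nonneg fun b _ => hw b)
        split_ifs
        exacts [hA, le_rfl]
    · intro d' _ hne
      exact (congrArg (ite _ · 0) (hinfl d' fun hd' => hne (hT.direction_unique hd' hd))).trans
        (ite_self 0)
    · simp
  · have hd' := hd
    push Not at hd'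
    rw [if_neg hd, ite_self, zero_add]
    refine le_trans (le_of_eq ?_) (Finset.sum_nonneg fun b _ => hw b)
    exact Finset.sum_eq_zero fun d _ =>
      (congrArg (ite _ · 0) (hinfl d (hd' d))).trans (ite_self 0)

/-- Passing from `n` to `n + 1` hops costs the bound on the virtual queue and one slot of service,
on top of the sum over all links of the queues of packets with less than `n` hops. -/
lemma queueBelow_succ_le (hU : C.IsUMWPlus N link β) (hE : C.IsENTO N link) (hβ : 0 < β)
    {H t : ℕ} (n : ℕ) (htH : t ≤ H) (e : E) :
    ∃ t₀ ≤ t, C.queueBelow N H (n + 1) t e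
      ≤ √(driftBound N β * t) + N.cap e + ∑ e', C.queueBelow N H n t₀ e' := by
  obtain ⟨t₀, ht₀, h⟩ := hE.exists_queueBelow_le_sum hU.admitted_nonneg (n + 1) htH e
  refine ⟨t₀, ht₀, h.trans ?_⟩
  have h1 := sum_sumBelow_inflow_le hU hE (n := n) ht₀ htH e
  have h2 := sum_arrival_sub_service_le (C := C) (N := N) (link := link) ht₀ e
  have h3 := hU.virtualQueue_le_sqrt hβ t e
  rw [Finset.sum_sub_distrib] at h2 ⊢
  linarith

lemma queueBelow_le (hU : C.IsUMWPlus N link β) (hE : C.IsENTO N link) (hβ : 0 < β)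
    {H t : ℕ} (n : ℕ) (htH : t ≤ H) (e : E) :
    C.queueBelow N H n t e ≤ (∑ i ∈ Finset.range n, (Fintype.card E : ℝ) ^ i)
      * (√(driftBound N β * t) + ∑ e, N.cap e) := by
  induction n generalizing t e with
  | zero => simp [queueBelow, sumBelow]
  | succ n ih =>
    obtain ⟨t₀, ht₀, h⟩ := queueBelow_succ_le hU hE hβ n htH e
    refine h.trans ?_
    have hcap : N.cap e ≤ ∑ e, N.cap e :=
      Finset.single_le_sum (fun e _ => N.cap_nonneg e) (Finset.mem_univ e)
    have hmono := hU.sqrt_driftBound_mono hβ ht₀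
    have h1 : ∀ e', C.queueBelow N H n t₀ e' ≤
        (∑ i ∈ Finset.range n, (Fintype.card E : ℝ) ^ i)
          * (√(driftBound N β * t) + ∑ e, N.cap e) := fun e' =>
      (ih (ht₀.trans htH) e').trans (mul_le_mul_of_nonneg_left (add_le_add_left hmono _)
        (Finset.sum_nonneg fun i _ => by positivity))
    have h2 := Finset.sum_le_sum fun e' (_ : e' ∈ Finset.univ) => h1 e'
    rw [Finset.sum_const, Finset.card_univ, nsmul_eq_mul] at h2
    rw [geom_sum_succ]
    linarith

/-- The numbers of hops are bounded, so all packets are counted eventually. -/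
lemma physicalQueue_eq_queueBelow (hU : C.IsUMWPlus N link β) (hE : C.IsENTO N link) (t : ℕ)
    (e : E) :
    C.physicalQueue N t e = C.queueBelow N t (Fintype.card (E × Bool)) t e := by
  unfold physicalQueue queueBelow sumBelow
  refine Finset.sum_congr rfl fun k _ => Finset.sum_congr rfl fun s _ =>
    Finset.sum_congr rfl fun d _ => ?_
  by_cases hd : (e, d) ∈ C.route s k
  · exact (if_pos ((hU.isTree s k).hops_lt_card hd)).symm
  · rw [hE.waiting_eq_zero_of_notMem t k s _ hd, ite_self]

lemma tendsto_physicalQueue_div (hU : C.IsUMWPlus N link β) (hE : C.IsENTO N link)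
    (hβ : 0 < β) :
    Tendsto (fun T : ℕ => (1 / (T : ℝ)) * ∑ e, C.physicalQueue N T e) atTop (𝓝 0) := by
  set D := driftBound N β
  set M := ∑ e, N.cap e
  set c : ℝ := Fintype.card E * ∑ i ∈ Finset.range (Fintype.card (E × Bool)),
    (Fintype.card E : ℝ) ^ i
  have hsum : ∀ T : ℕ, ∑ e, C.physicalQueue N T e ≤ c * (√(D * T) + M) := by
    intro T
    have h := Finset.sum_le_sum fun e (_ : e ∈ Finset.univ) =>
      (physicalQueue_eq_queueBelow hU hE T e).trans_le (queueBelow_le hU hE hβ _ le_rfl e)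
    rwa [Finset.sum_const, Finset.card_univ, nsmul_eq_mul, ← mul_assoc] at h
  have hlim : Tendsto (fun T : ℕ => c * (√D * (√(T : ℝ))⁻¹ + M * (T : ℝ)⁻¹)) atTop (𝓝 0) := by
    have h1 : Tendsto (fun T : ℕ => (√(T : ℝ))⁻¹) atTop (𝓝 0) :=
      (Real.tendsto_sqrt_atTop.comp tendsto_natCast_atTop_atTop).inv_tendsto_atTop
    have h2 : Tendsto (fun T : ℕ => (T : ℝ)⁻¹) atTop (𝓝 0) :=
      tendsto_natCast_atTop_atTop.inv_tendsto_atTop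
    simpa using ((h1.const_mul √D).add (h2.const_mul M)).const_mul c
  refine tendsto_of_tendsto_of_tendsto_of_le_of_le tendsto_const_nhds hlim (fun T => ?_)
    fun T => ?_
  · refine mul_nonneg (by positivity) (Finset.sum_nonneg fun e _ => ?_)
    rw [physicalQueue_eq_queueBelow hU hE]
    exact sumBelow_nonneg _ _ _ fun k s a => hE.waiting_nonneg T k s a
  · have hT : (0 : ℝ) ≤ (T : ℝ) := Nat.cast_nonneg T
    refine (mul_le_mul_of_nonneg_left (hsum T) (by positivity)).trans_eq ?_
    rw [Real.sqrt_mul' D hT, ← Real.sqrt_div_self]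
    ring

end Queues

end Controls

theorem theorem2 {V : Type*} {E : Type*} {K : Type*} [Fintype V] [Fintype E] [Fintype K]
    (N : Network V E K) (β : ℝ) (hβ : 0 < β)
    {Ω : Type*} [MeasurableSpace Ω] (P : Measure Ω) [IsProbabilityMeasure P]
    (σ : Ω → ℕ → E → Bool) (hσ : IsStationaryErgodic σ P)
    (C : Ω → Controls E K)
    (hUMW : ∀ᵐ ω ∂P, (C ω).IsUMWPlus N (σ ω) β)
    (hENTO : ∀ᵐ ω ∂P, (C ω).IsENTO N (σ ω)) :
    ∀ᵐ ω ∂P, Tendsto (fun T : ℕ => (1 / (T : ℝ)) * ∑ e, (C ω).physicalQueue N T e)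
      atTop (𝓝 0) := by
  filter_upwards [hUMW, hENTO] with ω hU hE
  exact Controls.tendsto_physicalQueue_div hU hE hβ
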